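/- For $f:\mathbb R\to\mathbb R$ let $V[f]\in[0,\infty]$ be its Jordan variation, i.e. the supremum of $\sum_{i=1}^N|f(x_i)-f(x_{i-1})|$ over all finite sequences $x_0<x_1<\dots<x_N$ in $\mathbb R$. Let $BV(\mathbb R)$ be the set of $f:\mathbb R\to\mathbb R$ with $V[f]<+\infty$, and let $AC(\mathbb R)$ be the set of $f\in BV(\mathbb R)$ that are absolutely continuous on every interval $[a,b]\subset\mathbb R$. For an integer $n\ge 2$ let $$M_n(x)=\frac1{(n-1)!}\sum_{i=0}^n(-1)^i\binom ni\left(\frac n2+x-i\right)_+^{n-1},\qquad x\in\mathbb R,\quad (y)_+=\max\{y,0\},$$ be the central B-spline of order $n$, and for $f:\mathbb R\to\mathbb R$ and $w>0$ let $$(S^{M_n}_wf)(t)=\sum_{k\in\mathbb Z}f\left(\frac kw\right)M_n(wt-k),\qquad t\in\mathbb R,$$ be the generalized sampling series with kernel $M_n$ (for each $t$ the sum has only finitely many nonzero terms, since $M_n$ has compact support). Corollary. Let $n\ge2$ and $f\in BV(\mathbb R)$. Then $$\lim_{w\to+\infty}V[S^{M_n}_wf-f]=0\quad\text{if and only if}\quad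 f\in AC(\mathbb R).$$ -/

import Mathlib

open Filter Topology

/-- The Jordan variation `V[f]` of `f` over the whole real line, with values in `[0, ∞]`. -/
noncomputable def totalVariation (f : ℝ → ℝ) : ENNReal :=
  eVariationOn f Set.univ

/-- `BV(ℝ)`: the functions of finite Jordan variation over the real line. -/
def IsBV (f : ℝ → ℝ) : Prop :=
  totalVariation f < ⊤

/-- `AC(ℝ) = BV(ℝ) ∩ AC_loc(ℝ)`: the functions of finite variation that are absolutely continuous
on every compact interval. -/
def IsAC (f : ℝ → ℝ) : Prop :=
  IsBV f ∧ ∀ a b : ℝ, a ≤ b → AbsolutelyContinuousOnInterval f a b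

/-- The central B-spline `M_n` of order `n`, for `n ≥ 2` (for `n = 1` the power `0 ^ 0` would need
a separate convention). -/
noncomputable def centralBSpline (n : ℕ) (x : ℝ) : ℝ :=
  (1 / (Nat.factorial (n - 1) : ℝ)) *
    ∑ i ∈ Finset.range (n + 1),
      (-1 : ℝ) ^ i * (Nat.choose n i : ℝ) * (max ((n : ℝ) / 2 + x - (i : ℝ)) 0) ^ (n - 1)

/-- The generalized sampling series `(S_w f)(t) = ∑_{k ∈ ℤ} f(k / w) χ(w t - k)` with kernel `χ`.
For a kernel of compact support only finitely many terms are nonzero, for every `t`. -/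
noncomputable def samplingSeries (χ : ℝ → ℝ) (w : ℝ) (f : ℝ → ℝ) (t : ℝ) : ℝ :=
  ∑' k : ℤ, f ((k : ℝ) / w) * χ (w * t - (k : ℝ))

open MeasureTheory Set


/-! Necessity: on a compact interval the series is a finite combination of dilated translates of
`centralBSpline n`, a polynomial expression in Lipschitz truncations, hence absolutely continuous.
An approximation in variation transfers this to `f`
(`absolutelyContinuousOnInterval_of_totalVariation_sub_lt`).

Sufficiency: `f` is a primitive of `g = deriv f`, which lies in `L¹`, so `‖g(· + u) - g‖₁ → 0` as `u
→ 0`. For `n = 2` the series interpolates `f` linearly between the nodes `k / w`. Its slope on a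
cell is the mean of `g` there, so the error has variation at most twice the supremum of these norms
over `|u| ≤ 1 / w`. Since `M_{n+1}` is `M_n` convolved with the indicator of `[-1/2, 1/2]`, the
series of order `n + 1` averages the translates by `y / w`, `|y| ≤ 1/2`, of that of order `n`.
Minkowski's inequality for the variation then gives induction on `n`. -/

/-! ### Estimates for the total variation -/

theorem totalVariation_le_lintegral {h : ℝ → ℝ} {Φ : ℝ → ENNReal}
    (hΦ : ∀ a b, a ≤ b → edist (h b) (h a) ≤ ∫⁻ x in Ioc a b, Φ x) :
    totalVariation h ≤ ∫⁻ x, Φ x := by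
  refine iSup_le fun p => ?_
  calc ∑ i ∈ Finset.range p.1, edist (h (p.2.1 (i + 1))) (h (p.2.1 i))
      ≤ ∑ i ∈ Finset.range p.1, ∫⁻ x in Ioc (p.2.1 i) (p.2.1 (i + 1)), Φ x :=
        Finset.sum_le_sum fun i _ => hΦ _ _ (p.2.2.1 (Nat.le_succ i))
    _ = ∫⁻ x in ⋃ i ∈ Finset.range p.1, Ioc (p.2.1 i) (p.2.1 (i + 1)), Φ x := by
        rw [lintegral_biUnion_finset _ (fun i _ => measurableSet_Ioc)]
        exact fun i _ j _ hij => p.2.2.1.pairwise_disjoint_on_Ioc_succ hij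
    _ ≤ ∫⁻ x, Φ x := setLIntegral_le_lintegral _ _

theorem totalVariation_add_le (f g : ℝ → ℝ) :
    totalVariation (fun x => f x + g x) ≤ totalVariation f + totalVariation g := by
  refine iSup_le fun p => ?_
  calc ∑ i ∈ Finset.range p.1, edist (f (p.2.1 (i + 1)) + g (p.2.1 (i + 1)))
        (f (p.2.1 i) + g (p.2.1 i))
      ≤ ∑ i ∈ Finset.range p.1, (edist (f (p.2.1 (i + 1))) (f (p.2.1 i)) +
          edist (g (p.2.1 (i + 1))) (g (p.2.1 i))) :=
        Finset.sum_le_sum fun i _ => edist_add_add_le _ _ _ _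
    _ ≤ totalVariation f + totalVariation g := by
        rw [Finset.sum_add_distrib]
        exact add_le_add (eVariationOn.sum_le p.2.2.1 fun _ => mem_univ _)
          (eVariationOn.sum_le p.2.2.1 fun _ => mem_univ _)

theorem totalVariation_comp_sub_const_le (f : ℝ → ℝ) (c : ℝ) :
    totalVariation (fun x => f (x - c)) ≤ totalVariation f :=
  eVariationOn.comp_le_of_monotoneOn f (fun x => x - c)
    (fun _ _ _ _ hxy => sub_le_sub_right hxy c) fun _ _ => mem_univ _

/-- Minkowski's inequality for the total variation of an average. -/
theorem totalVariation_integral_sub_le {G : ℝ → ℝ → ℝ} {f : ℝ → ℝ} {C : ENNReal}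
    (hG : ∀ t, Continuous (G t))
    (hC : ∀ y ∈ Icc (-(1 / 2) : ℝ) (1 / 2), totalVariation (fun t => G t y - f t) ≤ C) :
    totalVariation (fun t => (∫ y in (-(1 / 2) : ℝ)..(1 / 2), G t y) - f t) ≤ C := by
  refine iSup_le fun p => ?_
  have key : ∀ s t : ℝ, edist ((∫ y in (-(1 / 2) : ℝ)..(1 / 2), G t y) - f t)
      ((∫ y in (-(1 / 2) : ℝ)..(1 / 2), G s y) - f s) ≤
      ∫⁻ y in Ioc (-(1 / 2) : ℝ) (1 / 2), edist (G t y - f t) (G s y - f s) := by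
    intro s t
    have h : ((∫ y in (-(1 / 2) : ℝ)..(1 / 2), G t y) - f t) -
        ((∫ y in (-(1 / 2) : ℝ)..(1 / 2), G s y) - f s) =
        ∫ y in Ioc (-(1 / 2) : ℝ) (1 / 2), ((G t y - f t) - (G s y - f s)) := by
      rw [← intervalIntegral.integral_of_le (by norm_num),
        intervalIntegral.integral_sub, intervalIntegral.integral_sub,
        intervalIntegral.integral_sub]
      · norm_num
      all_goals
        have := hG t
        have := hG s
        exact Continuous.intervalIntegrable (by fun_prop) _ _
    rw [edist_eq_enorm_sub, h]
    refine (enorm_integral_le_lintegral_enorm _).trans (le_of_eq ?_)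
    simp_rw [edist_eq_enorm_sub]
  calc _ ≤ ∑ i ∈ Finset.range p.1, ∫⁻ y in Ioc (-(1 / 2) : ℝ) (1 / 2),
        edist (G (p.2.1 (i + 1)) y - f (p.2.1 (i + 1))) (G (p.2.1 i) y - f (p.2.1 i)) :=
        Finset.sum_le_sum fun i _ => key _ _
    _ = ∫⁻ y in Ioc (-(1 / 2) : ℝ) (1 / 2), ∑ i ∈ Finset.range p.1,
        edist (G (p.2.1 (i + 1)) y - f (p.2.1 (i + 1))) (G (p.2.1 i) y - f (p.2.1 i)) := by
        rw [lintegral_finsetSum']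
        intro i _
        have := hG (p.2.1 (i + 1))
        have := hG (p.2.1 i)
        exact (Continuous.measurable (by fun_prop)).aemeasurable
    _ ≤ ∫⁻ y in Ioc (-(1 / 2) : ℝ) (1 / 2), C := by
        refine setLIntegral_mono measurable_const fun y hy => ?_
        exact (eVariationOn.sum_le (f := fun t => G t y - f t) p.2.2.1 fun _ => mem_univ _).trans
          (hC y (Ioc_subset_Icc_self hy))
    _ = C := by
        rw [setLIntegral_const, Real.volume_Ioc]
        norm_num

/-- Bridges the unordered disjoint intervals of absolute continuity and the ordered points of the
variation. Remove the interval reaching furthest right: by disjointness the other nondegenerate ones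
end before it starts. -/
theorem sum_edist_le_totalVariation {ι : Type*} (g : ℝ → ℝ) (I : ι → ℝ × ℝ) (s : Finset ι)
    (hd : Set.PairwiseDisjoint (s : Set ι) fun i => uIoc (I i).1 (I i).2) :
    ∑ i ∈ s, edist (g (I i).1) (g (I i).2) ≤ totalVariation g := by
  classical
  -- Degenerate intervals are exempt from the bound `x`: their `uIoc` is empty, so disjointness does
  -- not locate them.
  suffices H : ∀ s : Finset ι, (Set.PairwiseDisjoint (s : Set ι) fun i => uIoc (I i).1 (I i).2) →
      ∀ x, (∀ i ∈ s, (I i).1 ≠ (I i).2 → max (I i).1 (I i).2 ≤ x) →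
      ∑ i ∈ s, edist (g (I i).1) (g (I i).2) ≤ eVariationOn g (Iic x) by
    obtain ⟨x, hx⟩ := (s.image fun i => max (I i).1 (I i).2).bddAbove
    exact (H s hd x fun i hi _ => hx (by simpa using ⟨i, hi, rfl⟩)).trans
      (eVariationOn.mono g (subset_univ _))
  intro s
  induction s using Finset.induction_on_max_value (fun i => max (I i).1 (I i).2) with
  | empty => simp
  | insert a s ha hmax ih =>
    intro hd x hx
    have hd' := hd.subset (Finset.coe_subset.2 (Finset.subset_insert a s))
    rw [Finset.sum_insert ha]
    rcases eq_or_ne (I a).1 (I a).2 with h | h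
    · rw [h, edist_self, zero_add]
      exact ih hd' x fun i hi => hx i (Finset.mem_insert_of_mem hi)
    · have hxa := hx a (Finset.mem_insert_self a s) h
      have hlt : min (I a).1 (I a).2 < max (I a).1 (I a).2 := min_lt_max.2 h
      set m := min (I a).1 (I a).2
      set M := max (I a).1 (I a).2
      have h1 : ∑ i ∈ s, edist (g (I i).1) (g (I i).2) ≤ eVariationOn g (Iic m) := by
        refine ih hd' m fun i hi hne => ?_
        by_contra! hcon
        have hdis := hd (Finset.mem_coe.2 (Finset.mem_insert_self a s))
          (Finset.mem_coe.2 (Finset.mem_insert_of_mem hi)) (by rintro rfl; exact ha hi)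
        have hmem : max (I i).1 (I i).2 ∈ uIoc (I a).1 (I a).2 := ⟨hcon, hmax i hi⟩
        exact Set.disjoint_left.1 hdis hmem ⟨min_lt_max.2 hne, le_rfl⟩
      have h2 : edist (g (I a).1) (g (I a).2) ≤ eVariationOn g (Icc m M) :=
        eVariationOn.edist_le g ⟨min_le_left _ _, le_max_left _ _⟩
          ⟨min_le_right _ _, le_max_right _ _⟩
      calc _ ≤ eVariationOn g (Iic m) + eVariationOn g (Icc m M) := by
            rw [add_comm]; exact add_le_add h1 h2
        _ ≤ eVariationOn g (Iic m ∪ Icc m M) :=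
            eVariationOn.add_le_union g fun x hx y hy => le_trans hx hy.1
        _ ≤ eVariationOn g (Iic x) := by
            refine eVariationOn.mono g (union_subset (Iic_subset_Iic.2 (hlt.le.trans hxa)) ?_)
            exact fun y hy => hy.2.trans hxa


/-! ### Integrability of the derivative and continuity of translation in `L¹` -/

/-- With `v` the variation function, `v - f` and `v + f` are monotone, so `|f'| ≤ v'` a.e.; the
integral of `v'` over an interval is at most the increment of `v`, hence at most `V[f]`. -/
theorem integrable_deriv_of_isBV {f : ℝ → ℝ} (hf : IsBV f) : Integrable (deriv f) := by
  have hfb : BoundedVariationOn f univ := hf.ne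
  have hfl := hfb.locallyBoundedVariationOn
  set v : ℝ → ℝ := variationOnFromTo f univ 0 with hv
  have hvm : Monotone v := by
    rw [← monotoneOn_univ]
    exact variationOnFromTo.monotoneOn hfl (mem_univ _)
  have hsub : Monotone (v - f) := by
    rw [← monotoneOn_univ]
    exact variationOnFromTo.sub_self_monotoneOn hfl (mem_univ _)
  have hvs : ∀ a b, a ≤ b → v b - v a = (eVariationOn f (univ ∩ Icc a b)).toReal := by
    intro a b hab
    rw [← variationOnFromTo.eq_of_le f univ hab, hv,
      ← variationOnFromTo.add hfl (mem_univ 0) (mem_univ a) (mem_univ b), add_sub_cancel_left]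
  have hadd : Monotone (v + f) := by
    intro a b hab
    have h1 : dist (f a) (f b) ≤ v b - v a := by
      rw [hvs a b hab]
      exact (hfb.mono inter_subset_left).dist_le ⟨mem_univ _, le_rfl, hab⟩ ⟨mem_univ _, hab, le_rfl⟩
    rw [Real.dist_eq] at h1
    have := le_abs_self (f a - f b)
    simp only [Pi.add_apply]
    linarith
  have hdom : ∀ᵐ x, ‖deriv f x‖ ≤ deriv v x := by
    filter_upwards [hfl.ae_differentiableAt, hvm.ae_differentiableAt] with x hx hx'
    have h1 : 0 ≤ deriv (v - f) x := hsub.deriv_nonneg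
    have h2 : 0 ≤ deriv (v + f) x := hadd.deriv_nonneg
    rw [deriv_sub hx' hx] at h1
    rw [deriv_add hx' hx] at h2
    rw [Real.norm_eq_abs, abs_le]
    constructor <;> linarith
  have hii : ∀ a b, IntervalIntegrable (deriv v) volume a b := fun a b =>
    (hvm.monotoneOn _).intervalIntegrable_deriv
  have hfi : ∀ a b, IntervalIntegrable (deriv f) volume a b := fun a b =>
    (hii a b).mono_fun' (measurable_deriv f).aestronglyMeasurable (ae_restrict_of_ae hdom)
  refine integrable_of_intervalIntegral_norm_bounded (totalVariation f).toReal
    (a := fun n : ℕ => -(n : ℝ)) (b := fun n : ℕ => (n : ℝ)) (l := atTop)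
    (fun n => (hfi _ _).1) ?_ ?_ ?_
  · exact tendsto_neg_atTop_atBot.comp tendsto_natCast_atTop_atTop
  · exact tendsto_natCast_atTop_atTop
  · refine Eventually.of_forall fun n => ?_
    have hn : -(n : ℝ) ≤ n := by have := n.cast_nonneg (α := ℝ); linarith
    calc ∫ x in -(n : ℝ)..n, ‖deriv f x‖ ≤ ∫ x in -(n : ℝ)..n, deriv v x :=
          intervalIntegral.integral_mono_ae hn (hfi _ _).norm (hii _ _) hdom
      _ ≤ v n - v (-n) := by
          have h := (hvm.monotoneOn (uIcc (-(n : ℝ)) n)).intervalIntegral_deriv_mem_uIcc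
          rw [uIcc_of_le (sub_nonneg.2 (hvm hn))] at h
          exact h.2
      _ ≤ (totalVariation f).toReal := by
          rw [hvs _ _ hn]
          exact ENNReal.toReal_mono hf.ne (eVariationOn.mono f inter_subset_left)

theorem tendsto_lintegral_enorm_translate_sub {g : ℝ → ℝ} (hg : Integrable g) :
    Tendsto (fun u : ℝ => ∫⁻ t, ‖g (t + u) - g t‖ₑ) (𝓝 0) (𝓝 0) := by
  have hmem : MemLp g 1 := memLp_one_iff_integrable.2 hg
  have : Fact ((1 : ENNReal) ≠ ⊤) := ⟨ENNReal.one_ne_top⟩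
  have hc : Continuous fun u : ℝ => (DomAddAct.mk u +ᵥ hmem.toLp g : Lp ℝ 1 volume) := by
    exact (DomAddAct.continuous_mk).vadd continuous_const
  have h := (hc.tendsto 0).edist (tendsto_const_nhds (x := hmem.toLp g))
  simp only [DomAddAct.mk_vadd_toLp, DomAddAct.mk_zero, zero_vadd, edist_self,
    Lp.edist_toLp_toLp, eLpNorm_one_eq_lintegral_enorm] at h
  refine h.congr fun u => lintegral_congr fun t => ?_
  simp [add_comm]


/-! ### B-splines: convolution recursion and compact support -/

@[fun_prop]
theorem continuous_centralBSpline (n : ℕ) : Continuous (centralBSpline n) := by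
  unfold centralBSpline
  fun_prop

theorem integral_max_zero_pow (m : ℕ) (c x : ℝ) :
    ∫ y in (-(1 / 2) : ℝ)..(1 / 2), (max (c + (x - y)) 0) ^ (m + 1) =
      ((max (c + x + 1 / 2) 0) ^ (m + 2) - (max (c + x - 1 / 2) 0) ^ (m + 2)) / (m + 2) := by
  have hd : ∀ u : ℝ, HasDerivAt (fun u : ℝ => (max u 0) ^ (m + 2)) ((m + 2) * (max u 0) ^ (m + 1)) u := by
    intro u
    rcases lt_trichotomy u 0 with hu | rfl | hu
    · rw [max_eq_right hu.le, zero_pow (by omega), mul_zero]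
      refine (hasDerivAt_const u (0 : ℝ)).congr_of_eventuallyEq ?_
      filter_upwards [Iio_mem_nhds hu] with v hv
      rw [max_eq_right (le_of_lt hv), zero_pow (by omega)]
    -- At the kink, the exponent `m + 2 ≥ 2` makes the truncated power `o(v)`.
    · rw [max_self, zero_pow (by omega), mul_zero, hasDerivAt_iff_isLittleO]
      have h : (fun v : ℝ => v ^ (m + 2)) =o[𝓝 0] fun v => v := by
        simpa using Asymptotics.isLittleO_pow_pow (𝕜 := ℝ) (m := 1) (n := m + 2) (by omega)
      refine (Asymptotics.IsBigO.of_bound 1 (Eventually.of_forall fun v => ?_)).trans_isLittleO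
        (h.congr_right fun v => (sub_zero v).symm)
      have h1 : max v 0 ≤ |v| := max_le (le_abs_self v) (abs_nonneg v)
      have h2 : (max v 0) ^ (m + 2) ≤ |v| ^ (m + 2) := pow_le_pow_left₀ (le_max_right _ _) h1 _
      have h3 : 0 ≤ (max v 0) ^ (m + 2) := pow_nonneg (le_max_right _ _) _
      rw [max_self, zero_pow (by omega : m + 2 ≠ 0), sub_zero, smul_zero, sub_zero, one_mul,
        Real.norm_of_nonneg h3, norm_pow, Real.norm_eq_abs]
      exact h2
    · have := (hasDerivAt_id u).pow (m + 2)
      rw [max_eq_left hu.le]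
      refine (this.congr_of_eventuallyEq ?_).congr_deriv ?_
      · filter_upwards [Ioi_mem_nhds hu] with v hv
        rw [max_eq_left (le_of_lt hv)]
        rfl
      · simp
  have hd' : ∀ y ∈ uIcc (-(1 / 2) : ℝ) (1 / 2), HasDerivAt
      (fun y : ℝ => -((max (c + (x - y)) 0) ^ (m + 2) / (m + 2)))
      ((max (c + (x - y)) 0) ^ (m + 1)) y := by
    intro y _
    have h1 : HasDerivAt (fun y : ℝ => c + (x - y)) (-1) y :=
      ((hasDerivAt_id y).const_sub x).const_add c
    have h2 := (((hd (c + (x - y))).comp y h1).div_const ((m : ℝ) + 2)).neg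
    refine h2.congr_deriv ?_
    field_simp
  rw [intervalIntegral.integral_eq_sub_of_hasDerivAt hd'
    (Continuous.intervalIntegrable (by fun_prop) _ _)]
  ring_nf

theorem sum_alternating_choose_succ (N : ℕ) (φ : ℕ → ℝ) :
    ∑ i ∈ Finset.range (N + 2), (-1 : ℝ) ^ i * ((N + 1).choose i : ℝ) * φ i =
      ∑ i ∈ Finset.range (N + 1), (-1 : ℝ) ^ i * (N.choose i : ℝ) * (φ i - φ (i + 1)) := by
  rw [Finset.sum_range_succ']
  simp only [Nat.choose_succ_succ, Nat.cast_add, mul_add, add_mul, Finset.sum_add_distrib, mul_sub,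
    Finset.sum_sub_distrib]
  have h : ∑ i ∈ Finset.range (N + 1), (-1 : ℝ) ^ (i + 1) * (N.choose (i + 1) : ℝ) * φ (i + 1) +
      (-1) ^ 0 * ((N + 1).choose 0 : ℝ) * φ 0 =
      ∑ i ∈ Finset.range (N + 1), (-1 : ℝ) ^ i * (N.choose i : ℝ) * φ i := by
    rw [Finset.sum_range_succ, Finset.sum_range_succ' _ N]
    simp
  rw [add_assoc, h, add_comm, sub_eq_add_neg, ← Finset.sum_neg_distrib]
  congr 1
  refine Finset.sum_congr rfl fun i _ => ?_
  ring

/-- Averaging a truncated power over a unit window gives a unit difference of the next power;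
Pascal's rule absorbs it into the alternating sum. -/
theorem centralBSpline_succ {n : ℕ} (hn : 2 ≤ n) (x : ℝ) :
    centralBSpline (n + 1) x = ∫ y in (-(1 / 2) : ℝ)..(1 / 2), centralBSpline n (x - y) := by
  obtain ⟨m, rfl⟩ := Nat.exists_eq_add_of_le' hn
  unfold centralBSpline
  rw [intervalIntegral.integral_const_mul, intervalIntegral.integral_finsetSum
    fun i _ => Continuous.intervalIntegrable (by fun_prop) _ _]
  rw [sum_alternating_choose_succ (m + 2)]
  simp only [intervalIntegral.integral_const_mul]
  have hI : ∀ i : ℕ, ∫ y in (-(1 / 2) : ℝ)..(1 / 2),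
      (max (((m + 2 : ℕ) : ℝ) / 2 + (x - y) - i) 0) ^ (m + 2 - 1) =
      ((max (((m + 2 + 1 : ℕ) : ℝ) / 2 + x - i) 0) ^ (m + 2 + 1 - 1) -
        (max (((m + 2 + 1 : ℕ) : ℝ) / 2 + x - (i + 1 : ℕ)) 0) ^ (m + 2 + 1 - 1)) / (m + 2) := by
    intro i
    have h := integral_max_zero_pow m (((m + 2 : ℕ) : ℝ) / 2 - i) x
    have e1 : ∀ y, ((m + 2 : ℕ) : ℝ) / 2 + (x - y) - i = ((m + 2 : ℕ) : ℝ) / 2 - i + (x - y) :=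
      fun y => by ring
    have e2 : ((m + 2 + 1 : ℕ) : ℝ) / 2 + x - i = ((m + 2 : ℕ) : ℝ) / 2 - i + x + 1 / 2 := by
      push_cast
      ring
    have e3 : ((m + 2 + 1 : ℕ) : ℝ) / 2 + x - (i + 1 : ℕ) =
        ((m + 2 : ℕ) : ℝ) / 2 - i + x - 1 / 2 := by
      push_cast
      ring
    simp only [e1]
    rw [e2, e3]
    exact h
  simp only [hI]
  have hf : ((m + 2 + 1 - 1).factorial : ℝ) = (m + 2) * ((m + 2 - 1).factorial : ℝ) := by
    simp only [Nat.add_sub_cancel, show m + 2 - 1 = m + 1 from rfl]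
    rw [Nat.factorial_succ]
    push_cast
    ring
  rw [hf]
  have : ((m + 2 - 1).factorial : ℝ) ≠ 0 := by positivity
  rw [Finset.mul_sum, Finset.mul_sum]
  refine Finset.sum_congr rfl fun i _ => ?_
  field_simp

theorem centralBSpline_two (x : ℝ) : centralBSpline 2 x = max (1 - |x|) 0 := by
  simp only [centralBSpline, Finset.sum_range_succ, Finset.sum_range_zero]
  norm_num
  rcases le_total x 0 with hx | hx
  · rw [abs_of_nonpos hx, max_eq_right hx, max_eq_right (by linarith : 1 + x - 2 ≤ 0)]
    simp
  · rw [abs_of_nonneg hx, max_eq_left hx, max_eq_left (by linarith : 0 ≤ 1 + x)]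
    rcases le_total x 1 with h | h
    · rw [max_eq_right (by linarith : 1 + x - 2 ≤ 0), max_eq_left (by linarith : 0 ≤ 1 - x)]
      ring
    · rw [max_eq_left (by linarith : 0 ≤ 1 + x - 2), max_eq_right (by linarith : 1 - x ≤ 0)]
      ring

/-- The radius `n` is cruder than the true `n / 2`, but only compactness matters, and each averaging
needs just `1 / 2` more. -/
theorem centralBSpline_eq_zero {n : ℕ} (hn : 2 ≤ n) {x : ℝ} (hx : (n : ℝ) ≤ |x|) :
    centralBSpline n x = 0 := by
  induction n, hn using Nat.le_induction generalizing x with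
  | base =>
    rw [centralBSpline_two]
    push_cast at hx
    exact max_eq_right (by linarith)
  | succ n hn ih =>
    rw [centralBSpline_succ hn, intervalIntegral.integral_congr (g := fun _ => 0)]
    · simp
    · intro y hy
      rw [uIcc_of_le (by norm_num)] at hy
      refine ih ?_
      push_cast at hx
      have h1 : |y| ≤ 1 / 2 := abs_le.2 hy
      have h2 := abs_sub_abs_le_abs_sub x y
      linarith


/-! ### Sampling series as locally finite sums -/

theorem samplingSeries_eq_sum {χ : ℝ → ℝ} {R : ℝ} (hχ : ∀ x, R ≤ |x| → χ x = 0) (f : ℝ → ℝ)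
    {w T t : ℝ} (ht : |w * t| ≤ T) : samplingSeries χ w f t =
      ∑ k ∈ Finset.Icc (-⌈T + R⌉) ⌈T + R⌉, f ((k : ℝ) / w) * χ (w * t - k) := by
  refine tsum_eq_sum fun k hk => ?_
  rw [hχ, mul_zero]
  by_contra! hcon
  refine hk (Finset.mem_Icc.2 (abs_le.1 ?_))
  have h1 : |(k : ℝ)| ≤ T + R := by
    have := abs_sub_abs_le_abs_sub (k : ℝ) (w * t)
    rw [abs_sub_comm] at this
    linarith
  have h2 : ((|k| : ℤ) : ℝ) ≤ (⌈T + R⌉ : ℝ) := by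
    rw [Int.cast_abs]
    exact h1.trans (Int.le_ceil _)
  exact_mod_cast h2

theorem continuous_samplingSeries {χ : ℝ → ℝ} (hc : Continuous χ) {R : ℝ}
    (hχ : ∀ x, R ≤ |x| → χ x = 0) (f : ℝ → ℝ) (w : ℝ) : Continuous (samplingSeries χ w f) := by
  rw [continuous_iff_continuousAt]
  intro t
  have h : samplingSeries χ w f =ᶠ[𝓝 t] fun s =>
      ∑ k ∈ Finset.Icc (-⌈|w * t| + 1 + R⌉) ⌈|w * t| + 1 + R⌉, f ((k : ℝ) / w) * χ (w * s - k) := by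
    have h1 : ∀ᶠ s in 𝓝 t, |w * s| < |w * t| + 1 :=
      (Continuous.tendsto (f := fun s : ℝ => |w * s|) (by fun_prop) t).eventually_lt_const
        (lt_add_one _)
    filter_upwards [h1] with s hs using samplingSeries_eq_sum hχ f hs.le
  refine ContinuousAt.congr (Continuous.continuousAt ?_) h.symm
  fun_prop

theorem samplingSeries_centralBSpline_succ {n : ℕ} (hn : 2 ≤ n) (f : ℝ → ℝ) {w : ℝ} (hw : 0 < w)
    (t : ℝ) : samplingSeries (centralBSpline (n + 1)) w f t =
      ∫ y in (-(1 / 2) : ℝ)..(1 / 2), samplingSeries (centralBSpline n) w f (t - y / w) := by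
  -- The slack in the index range lets one finite set serve all `y`, so sum and integral commute.
  have hS : ∀ y ∈ uIcc (-(1 / 2) : ℝ) (1 / 2),
      samplingSeries (centralBSpline n) w f (t - y / w) =
      ∑ k ∈ Finset.Icc (-⌈|w * t| + 1 + (n + 1 : ℕ)⌉) ⌈|w * t| + 1 + (n + 1 : ℕ)⌉,
        f (k / w) * centralBSpline n (w * (t - y / w) - k) := by
    intro y hy
    rw [uIcc_of_le (by norm_num)] at hy
    refine samplingSeries_eq_sum (fun x hx => centralBSpline_eq_zero hn ?_) f ?_
    · push_cast at hx
      linarith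
    · have h1 : |y| ≤ 1 / 2 := abs_le.2 hy
      have h2 := abs_sub (w * t) y
      rw [mul_sub, mul_div_cancel₀ _ hw.ne']
      linarith
  have hterm : ∀ k : ℤ, f (k / w) * centralBSpline (n + 1) (w * t - k) =
      ∫ y in (-(1 / 2) : ℝ)..(1 / 2), f (k / w) * centralBSpline n (w * (t - y / w) - k) := by
    intro k
    rw [centralBSpline_succ hn, ← intervalIntegral.integral_const_mul]
    refine intervalIntegral.integral_congr fun y _ => ?_
    have : w * t - k - y = w * (t - y / w) - k := by
      field_simp
      ring
    simp only [this]
  rw [intervalIntegral.integral_congr hS, intervalIntegral.integral_finsetSum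
    fun i _ => Continuous.intervalIntegrable (by fun_prop) _ _,
    samplingSeries_eq_sum (fun x hx => centralBSpline_eq_zero (by omega) hx) f
      (le_add_of_nonneg_right zero_le_one)]
  exact Finset.sum_congr rfl fun k _ => hterm k

/-! ### Necessity of absolute continuity -/

theorem AbsolutelyContinuousOnInterval.finset_sum {ι : Type*} {a b : ℝ} (s : Finset ι)
    {F : ι → ℝ → ℝ} (h : ∀ i ∈ s, AbsolutelyContinuousOnInterval (F i) a b) :
    AbsolutelyContinuousOnInterval (fun x => ∑ i ∈ s, F i x) a b := by
  classical
  induction s using Finset.induction_on with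
  | empty =>
    simpa using ((LipschitzWith.const (0 : ℝ)).lipschitzOnWith
      (s := uIcc a b)).absolutelyContinuousOnInterval
  | insert i s hi ih =>
    simp only [Finset.sum_insert hi]
    exact (h i (Finset.mem_insert_self i s)).fun_add
      (ih fun j hj => h j (Finset.mem_insert_of_mem hj))

theorem AbsolutelyContinuousOnInterval.pow {F : ℝ → ℝ} {a b : ℝ}
    (h : AbsolutelyContinuousOnInterval F a b) (m : ℕ) :
    AbsolutelyContinuousOnInterval (fun x => F x ^ m) a b := by
  induction m with
  | zero =>
    simpa using ((LipschitzWith.const (1 : ℝ)).lipschitzOnWith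
      (s := uIcc a b)).absolutelyContinuousOnInterval
  | succ m ih =>
    simp only [pow_succ]
    exact ih.fun_mul h

theorem absolutelyContinuousOnInterval_centralBSpline_comp (n : ℕ) (w c a b : ℝ) :
    AbsolutelyContinuousOnInterval (fun t => centralBSpline n (w * t - c)) a b := by
  unfold centralBSpline
  refine AbsolutelyContinuousOnInterval.const_mul _
    (AbsolutelyContinuousOnInterval.finset_sum _ fun i _ =>
      AbsolutelyContinuousOnInterval.const_mul _ (AbsolutelyContinuousOnInterval.pow ?_ _))
  have h : LipschitzWith ‖w‖₊ fun t : ℝ => max ((n : ℝ) / 2 + (w * t - c) - i) 0 := by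
    refine LipschitzWith.max_const (LipschitzWith.of_dist_le_mul fun x y => ?_) 0
    rw [Real.dist_eq, Real.dist_eq, coe_nnnorm, Real.norm_eq_abs, ← abs_mul]
    exact le_of_eq (congrArg _ (by ring))
  exact h.lipschitzOnWith.absolutelyContinuousOnInterval

theorem absolutelyContinuousOnInterval_of_totalVariation_sub_lt {f : ℝ → ℝ} {a b : ℝ}
    (h : ∀ ε > (0 : ℝ), ∃ S G : ℝ → ℝ, totalVariation (fun t => S t - f t) < ENNReal.ofReal ε ∧
      AbsolutelyContinuousOnInterval G a b ∧ EqOn S G (uIcc a b)) :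
    AbsolutelyContinuousOnInterval f a b := by
  rw [absolutelyContinuousOnInterval_iff]
  intro ε hε
  obtain ⟨S, G, hS, hG, hSG⟩ := h (ε / 2) (half_pos hε)
  obtain ⟨δ, hδ, hGδ⟩ := (absolutelyContinuousOnInterval_iff G a b).1 hG (ε / 2) (half_pos hε)
  refine ⟨δ, hδ, fun E hE hlt => ?_⟩
  have h1 := hGδ E hE hlt
  have h2 := (sum_edist_le_totalVariation (fun t => S t - f t) E.2 (Finset.range E.1) hE.2).trans_lt hS
  simp only [edist_dist] at h2
  rw [← ENNReal.ofReal_sum_of_nonneg fun _ _ => dist_nonneg,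
    ENNReal.ofReal_lt_ofReal_iff (half_pos hε)] at h2
  calc ∑ i ∈ Finset.range E.1, dist (f (E.2 i).1) (f (E.2 i).2)
      ≤ ∑ i ∈ Finset.range E.1, (dist (G (E.2 i).1) (G (E.2 i).2) +
          dist (S (E.2 i).1 - f (E.2 i).1) (S (E.2 i).2 - f (E.2 i).2)) := by
        refine Finset.sum_le_sum fun i hi => ?_
        rw [← hSG (hE.1 i hi).1, ← hSG (hE.1 i hi).2]
        have := dist_sub_sub_le (S (E.2 i).1) (S (E.2 i).1 - f (E.2 i).1) (S (E.2 i).2) (S (E.2 i).2 - f (E.2 i).2)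
        simpa using this
    _ < ε := by
        rw [Finset.sum_add_distrib]
        linarith

theorem isAC_of_tendsto {n : ℕ} (hn : 2 ≤ n) {f : ℝ → ℝ} (hf : IsBV f)
    (h : Tendsto (fun w : ℝ => totalVariation
      (fun t => samplingSeries (centralBSpline n) w f t - f t)) atTop (𝓝 0)) : IsAC f := by
  refine ⟨hf, fun a b _ => absolutelyContinuousOnInterval_of_totalVariation_sub_lt fun ε hε => ?_⟩
  obtain ⟨w, hw⟩ := (h.eventually_lt_const (ENNReal.ofReal_pos.2 hε)).exists
  refine ⟨_, _, hw, AbsolutelyContinuousOnInterval.finset_sum _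
    (F := fun (k : ℤ) t => f (k / w) * centralBSpline n (w * t - k)) fun k _ =>
    (absolutelyContinuousOnInterval_centralBSpline_comp n w k a b).const_mul (f (k / w)),
    fun t ht => samplingSeries_eq_sum (T := |w| * max |a| |b|)
      (fun _ => centralBSpline_eq_zero hn) f ?_⟩
  rw [abs_mul]
  refine mul_le_mul_of_nonneg_left ?_ (abs_nonneg w)
  rcases le_total a b with hab | hab
  · rw [uIcc_of_le hab] at ht
    exact abs_le_max_abs_abs ht.1 ht.2
  · rw [uIcc_of_ge hab] at ht
    rw [max_comm]
    exact abs_le_max_abs_abs ht.1 ht.2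


/-! ### Order two: piecewise linear interpolation -/

theorem samplingSeries_centralBSpline_two {f : ℝ → ℝ} {w t : ℝ} {k : ℤ} (h1 : k ≤ w * t)
    (h2 : w * t ≤ k + 1) : samplingSeries (centralBSpline 2) w f t =
      f (k / w) + (w * t - k) * (f ((k + 1) / w) - f (k / w)) := by
  have hk : k ≠ k + 1 := by omega
  unfold samplingSeries
  rw [tsum_eq_sum (s := {k, k + 1}), Finset.sum_pair hk, centralBSpline_two, centralBSpline_two]
  · push_cast
    rw [abs_of_nonneg (by linarith), abs_of_nonpos (by linarith), max_eq_left (by linarith),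
      max_eq_left (by linarith)]
    ring
  · intro j hj
    simp only [Finset.mem_insert, Finset.mem_singleton, not_or] at hj
    rw [centralBSpline_two, max_eq_right, mul_zero]
    rcases lt_or_gt_of_ne hj.1 with h | h
    · have : (j : ℝ) + 1 ≤ k := by exact_mod_cast h
      have := le_abs_self (w * t - j)
      linarith
    · have h' : k + 1 < j := by omega
      have : (k : ℝ) + 1 + 1 ≤ j := by exact_mod_cast h'
      have := neg_abs_le (w * t - j)
      linarith

theorem edist_le_lintegral_of_cells {h : ℝ → ℝ} {Φ : ℝ → ENNReal} {w : ℝ} (hw : 0 < w)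
    (hΦ : ∀ (k : ℤ) (a b : ℝ), k ≤ w * a → a ≤ b → w * b ≤ k + 1 →
      edist (h b) (h a) ≤ ∫⁻ x in Ioc a b, Φ x) {a b : ℝ} (hab : a ≤ b) :
    edist (h b) (h a) ≤ ∫⁻ x in Ioc a b, Φ x := by
  -- `N` bounds the number of further cells reached after that of `a`; each step cuts at the next
  -- node `c`.
  have H : ∀ (N : ℕ) (a b : ℝ), a ≤ b → w * b ≤ ⌊w * a⌋ + 1 + N →
      edist (h b) (h a) ≤ ∫⁻ x in Ioc a b, Φ x := by
    intro N
    induction N with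
    | zero =>
      intro a b hab hb
      exact hΦ ⌊w * a⌋ a b (Int.floor_le _) hab (by simpa using hb)
    | succ N ih =>
      intro a b hab hb
      rcases le_total (w * b) (⌊w * a⌋ + 1) with hb' | hb'
      · exact hΦ ⌊w * a⌋ a b (Int.floor_le _) hab hb'
      · set c : ℝ := (⌊w * a⌋ + 1) / w with hc
        have hwc : w * c = ((⌊w * a⌋ + 1 : ℤ) : ℝ) := by
          push_cast
          exact mul_div_cancel₀ _ hw.ne'
        have hac : a ≤ c := by
          rw [hc, le_div_iff₀ hw, mul_comm]
          exact (Int.lt_floor_add_one _).le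
        have hcb : c ≤ b := by
          rw [hc, div_le_iff₀ hw, mul_comm b]
          exact hb'
        have h1 := hΦ ⌊w * a⌋ a c (Int.floor_le _) hac (by rw [hwc]; push_cast; exact le_rfl)
        have h2 := ih c b hcb (by
          rw [hwc, Int.floor_intCast]
          push_cast at hb ⊢
          linarith)
        rw [← Ioc_union_Ioc_eq_Ioc hac hcb,
          lintegral_union measurableSet_Ioc (Ioc_disjoint_Ioc_of_le le_rfl), add_comm]
        exact (edist_triangle _ (h c) _).trans (add_le_add h2 h1)
  obtain ⟨N, hN⟩ := exists_nat_ge (w * b - (⌊w * a⌋ + 1))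
  exact H N a b hab (by linarith)

/-! ### Sufficiency: primitives of integrable functions -/

section Primitive

variable {f g : ℝ → ℝ}

theorem totalVariation_translate_sub_le (hg : Integrable g)
    (hfg : ∀ a b, ∫ x in a..b, g x = f b - f a) (c : ℝ) :
    totalVariation (fun t => f (t - c) - f t) ≤ ∫⁻ t, ‖g (t + -c) - g t‖ₑ := by
  refine totalVariation_le_lintegral fun a b hab => ?_
  have h : f (b - c) - f b - (f (a - c) - f a) = ∫ t in Ioc a b, (g (t + -c) - g t) := by
    rw [← intervalIntegral.integral_of_le hab, intervalIntegral.integral_sub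
      (hg.comp_add_right (-c)).intervalIntegrable hg.intervalIntegrable,
      intervalIntegral.integral_comp_add_right, hfg, hfg]
    simp only [← sub_eq_add_neg]
    ring
  rw [edist_eq_enorm_sub, h]
  exact enorm_integral_le_lintegral_enorm _

/-- Inside a cell the error is a primitive of `w * ∫ (g s - g t) ds`, taken over the cell. Enlarging
the cell to the window `|s - t| ≤ 1 / w` makes the bound independent of `k`. -/
theorem edist_samplingSeries_two_sub_le (hg : Integrable g)
    (hfg : ∀ a b, ∫ x in a..b, g x = f b - f a) {w : ℝ} (hw : 0 < w) {k : ℤ} {a b : ℝ}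
    (ha : k ≤ w * a) (hab : a ≤ b) (hb : w * b ≤ k + 1) :
    edist (samplingSeries (centralBSpline 2) w f b - f b)
      (samplingSeries (centralBSpline 2) w f a - f a) ≤
    ∫⁻ t in Ioc a b, ENNReal.ofReal w *
      ∫⁻ u in Icc (-(1 / w)) (1 / w), ‖g (t + u) - g t‖ₑ := by
  have hwab : w * a ≤ w * b := mul_le_mul_of_nonneg_left hab hw.le
  have hcell : (k : ℝ) / w ≤ (k + 1) / w := by gcongr; linarith
  have hlen : w * ((k + 1) / w - k / w) = 1 := by field_simp; ring
  have hinner : ∀ t, w * ∫ s in k / w..(k + 1) / w, (g s - g t) =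
      w * (f ((k + 1) / w) - f (k / w)) - g t := by
    intro t
    rw [intervalIntegral.integral_sub hg.intervalIntegrable intervalIntegrable_const, hfg,
      intervalIntegral.integral_const, smul_eq_mul, mul_sub, ← mul_assoc, hlen, one_mul]
  have h : samplingSeries (centralBSpline 2) w f b - f b -
      (samplingSeries (centralBSpline 2) w f a - f a) =
      ∫ t in Ioc a b, w * ∫ s in k / w..(k + 1) / w, (g s - g t) := by
    simp only [hinner]
    rw [← intervalIntegral.integral_of_le hab,
      intervalIntegral.integral_sub intervalIntegrable_const hg.intervalIntegrable, hfg,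
      intervalIntegral.integral_const, smul_eq_mul,
      samplingSeries_centralBSpline_two (ha.trans hwab) hb,
      samplingSeries_centralBSpline_two ha (hwab.trans hb)]
    ring
  rw [edist_eq_enorm_sub, h]
  refine (enorm_integral_le_lintegral_enorm _).trans
    (setLIntegral_mono' measurableSet_Ioc fun t ht => ?_)
  rw [enorm_mul, Real.enorm_eq_ofReal hw.le, intervalIntegral.integral_of_le hcell]
  gcongr
  refine (enorm_integral_le_lintegral_enorm _).trans ?_
  -- Substitute `s = t + u`, then compare indicators.
  rw [← lintegral_indicator measurableSet_Ioc, ← lintegral_indicator measurableSet_Icc,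
    ← lintegral_add_left_eq_self _ t]
  refine lintegral_mono fun u => ?_
  by_cases hu : t + u ∈ Ioc ((k : ℝ) / w) ((k + 1) / w)
  · have h1 : (k : ℝ) < w * (t + u) := by
      have := hu.1
      rwa [div_lt_iff₀ hw, mul_comm] at this
    have h2 : w * (t + u) ≤ k + 1 := by
      have := hu.2
      rwa [le_div_iff₀ hw, mul_comm] at this
    have h3 : w * a ≤ w * t := mul_le_mul_of_nonneg_left ht.1.le hw.le
    have h4 : w * t ≤ w * b := mul_le_mul_of_nonneg_left ht.2 hw.le
    have hu' : u ∈ Icc (-(1 / w)) (1 / w) := by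
      rw [mem_Icc, ← abs_le, le_div_iff₀ hw, ← abs_of_pos hw, ← abs_mul, abs_le]
      constructor <;> linarith
    rw [indicator_of_mem hu, indicator_of_mem hu']
  · rw [indicator_of_notMem hu]
    exact zero_le

/-- By Tonelli the `t`-integral comes first; the factor `2` is `w` times the window length `2 / w`.
-/
theorem totalVariation_samplingSeries_two_sub_le (hg : Integrable g) (hgm : Measurable g)
    (hfg : ∀ a b, ∫ x in a..b, g x = f b - f a) {w : ℝ} (hw : 0 < w) {ε : ENNReal}
    (hε : ∀ u, |u| ≤ 1 / w → ∫⁻ t, ‖g (t + u) - g t‖ₑ ≤ ε) :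
    totalVariation (fun t => samplingSeries (centralBSpline 2) w f t - f t) ≤ 2 * ε := by
  have hm : Measurable (Function.uncurry fun t u : ℝ => ‖g (t + u) - g t‖ₑ) := by
    unfold Function.uncurry
    fun_prop
  calc _ ≤ ∫⁻ t, ENNReal.ofReal w * ∫⁻ u in Icc (-(1 / w)) (1 / w), ‖g (t + u) - g t‖ₑ :=
        totalVariation_le_lintegral fun a b hab => edist_le_lintegral_of_cells hw
          (fun k a b => edist_samplingSeries_two_sub_le hg hfg hw) hab
    _ = ENNReal.ofReal w * ∫⁻ u in Icc (-(1 / w)) (1 / w), ∫⁻ t, ‖g (t + u) - g t‖ₑ := by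
        rw [lintegral_const_mul' _ _ ENNReal.ofReal_ne_top, lintegral_lintegral_swap hm.aemeasurable]
    _ ≤ ENNReal.ofReal w * ∫⁻ u in Icc (-(1 / w)) (1 / w), ε := by
        gcongr ENNReal.ofReal w * ?_
        exact setLIntegral_mono measurable_const fun u hu => hε u (abs_le.2 hu)
    _ = 2 * ε := by
        rw [setLIntegral_const, Real.volume_Icc, mul_comm ε, ← mul_assoc,
          ← ENNReal.ofReal_mul hw.le]
        congr 1
        rw [show w * (1 / w - -(1 / w)) = 2 by field_simp; norm_num]
        norm_num

theorem eventually_lintegral_enorm_translate_sub_le (hg : Integrable g) {ε : ENNReal} (hε : 0 < ε) :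
    ∀ᶠ w : ℝ in atTop, 0 < w ∧ ∀ u, |u| ≤ 1 / w → ∫⁻ t, ‖g (t + u) - g t‖ₑ ≤ ε := by
  obtain ⟨δ, hδ, h⟩ := Metric.eventually_nhds_iff.1
    (ENNReal.tendsto_nhds_zero.1 (tendsto_lintegral_enorm_translate_sub hg) ε hε)
  filter_upwards [eventually_gt_atTop (1 / δ), eventually_gt_atTop 0] with w hw hw0
  refine ⟨hw0, fun u hu => h ?_⟩
  rw [Real.dist_0_eq_abs]
  exact hu.trans_lt ((one_div_lt hw0 hδ).2 hw)

theorem tendsto_totalVariation_samplingSeries_sub (hg : Integrable g) (hgm : Measurable g)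
    (hfg : ∀ a b, ∫ x in a..b, g x = f b - f a) {n : ℕ} (hn : 2 ≤ n) :
    Tendsto (fun w : ℝ => totalVariation
      (fun t => samplingSeries (centralBSpline n) w f t - f t)) atTop (𝓝 0) := by
  induction n, hn using Nat.le_induction with
  | base =>
    refine ENNReal.tendsto_nhds_zero.2 fun ε hε => ?_
    filter_upwards [eventually_lintegral_enorm_translate_sub_le hg (ENNReal.half_pos hε.ne')]
      with w hw
    refine (totalVariation_samplingSeries_two_sub_le hg hgm hfg hw.1 hw.2).trans_eq ?_
    exact ENNReal.mul_div_cancel two_ne_zero ENNReal.ofNat_ne_top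
  | succ n hn ih =>
    refine ENNReal.tendsto_nhds_zero.2 fun ε hε => ?_
    filter_upwards [eventually_lintegral_enorm_translate_sub_le hg (ENNReal.half_pos hε.ne'),
      ENNReal.tendsto_nhds_zero.1 ih _ (ENNReal.half_pos hε.ne')] with w hw hwn
    simp only [samplingSeries_centralBSpline_succ hn f hw.1]
    have hc : Continuous (samplingSeries (centralBSpline n) w f) :=
      continuous_samplingSeries (by fun_prop) (fun _ => centralBSpline_eq_zero hn) f w
    refine totalVariation_integral_sub_le (fun t => by fun_prop) fun y hy => ?_
    have hy' : |-(y / w)| ≤ 1 / w := by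
      rw [abs_neg, abs_div, abs_of_pos hw.1]
      have : |y| ≤ 1 / 2 := abs_le.2 hy
      have hw0 := hw.1
      gcongr
      linarith
    -- Split into the translated error of order `n` and the translation error of `f`.
    calc totalVariation (fun t => samplingSeries (centralBSpline n) w f (t - y / w) - f t)
        = totalVariation (fun t => (samplingSeries (centralBSpline n) w f (t - y / w) -
            f (t - y / w)) + (f (t - y / w) - f t)) := by
          congr 1
          funext t
          ring
      _ ≤ ε / 2 + ε / 2 := (totalVariation_add_le _ _).trans (add_le_add
          ((totalVariation_comp_sub_const_le
            (fun t => samplingSeries (centralBSpline n) w f t - f t) (y / w)).trans hwn)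
          ((totalVariation_translate_sub_le hg hfg _).trans (hw.2 _ hy')))
      _ = ε := ENNReal.add_halves ε

end Primitive

theorem corollary4p1 (n : ℕ) (hn : 2 ≤ n) (f : ℝ → ℝ) (hf : IsBV f) :
    Tendsto (fun w : ℝ => totalVariation (fun t => samplingSeries (centralBSpline n) w f t - f t))
      atTop (𝓝 0) ↔ IsAC f := by
  refine ⟨isAC_of_tendsto hn hf, fun h => ?_⟩
  refine tendsto_totalVariation_samplingSeries_sub (integrable_deriv_of_isBV hf)
    (measurable_deriv f) (fun a b => ?_) hn
  rcases le_total a b with hab | hab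
  · exact (h.2 a b hab).integral_deriv_eq_sub
  · exact (h.2 b a hab).symm.integral_deriv_eq_sub
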